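/- **Setting.** Let $E_{11},A_{11}\in\mathbb R^{n_1\times n_1}$, $E_{12},A_{12}\in\mathbb R^{n_1\times n_2}$, $A_{21}\in\mathbb R^{n_2\times n_1}$, $A_{22}\in\mathbb R^{n_2\times n_2}$, $B_1\in\mathbb R^{n_1\times m}$, $B_2\in\mathbb R^{n_2\times m}$, $C_1\in\mathbb R^{p\times n_1}$, $C_2\in\mathbb R^{p\times n_2}$, $D\in\mathbb R^{p\times m}$, and suppose that $A_{22}$ and $S=E_{11}-E_{12}A_{22}^{-1}A_{21}$ are nonsingular. Put $$E=\begin{bmatrix}E_{11}&E_{12}\\0&0\end{bmatrix},\quad A=\begin{bmatrix}A_{11}&A_{12}\\A_{21}&A_{22}\end{bmatrix},\quad B=\begin{bmatrix}B_1\\B_2\end{bmatrix},\quad C=[\,C_1,\ C_2\,],\quad G(s)=C(sE-A)^{-1}B+D,$$ $$M_1=S^{-1}E_{12}A_{22}^{-1},\qquad M_2=-A_{22}^{-1}A_{21}S^{-1}E_{12}A_{22}^{-1}-A_{22}^{-1},\qquad \widetilde D=C_1M_1B_2+C_2M_2B_2+D.$$ **Iteration.** The data are shifts $\sigma_i\in\mathbb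 C$ and tangential directions $\mathsf b_i\in\mathbb C^m$, $\mathsf c_i\in\mathbb C^p$, $i=1,\dots,r$. For data with all $\sigma_iE-A$ nonsingular let $\mathcal B=[\mathsf b_1,\dots,\mathsf b_r]$, $\mathcal C=[\mathsf c_1,\dots,\mathsf c_r]$, $$V=[(\sigma_1E-A)^{-1}B\mathsf b_1,\dots,(\sigma_rE-A)^{-1}B\mathsf b_r],\qquad W=[(\sigma_1E-A)^{-T}C^T\mathsf c_1,\dots,(\sigma_rE-A)^{-T}C^T\mathsf c_r],$$ $$\widetilde E=W^TEV,\quad \widetilde A=W^TAV+\mathcal C^T(\widetilde D-D)\mathcal B,\quad \widetilde B=W^TB-\mathcal C^T(\widetilde D-D),\quad \widetilde C=CV-(\widetilde D-D)\mathcal B.$$ One step of the iteration computes matrices $Y=[y_1,\dots,y_r]$ and $Z=[z_1,\dots,z_r]$ with $Y^*\widetilde AZ=\operatorname{diag}(\lambda_1,\dots,\lambda_r)$ and $Y^*\widetilde EZ=I_r$, and replaces $\sigma_i\leftarrow-\lambda_i$, $\mathsf b_i^T\leftarrow y_i^*\widetilde B$, $\mathsf c_i\leftarrow\widetilde Cz_i$.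 (Every such choice of $Y,Z$ is allowed.) **Claim.** Suppose that the iteration, started at some initial data, can be carried out at every step and that its iterates $(\sigma_i,\mathsf b_i,\mathsf c_i)_{i\le r}$ converge (in particular, they may become stationary). From now on let $\sigma_i,\mathsf b_i,\mathsf c_i$ denote the limits, suppose that the $\sigma_i$ are distinct and all $\sigma_iE-A$ are nonsingular, let $\widetilde E,\widetilde A,\widetilde B,\widetilde C$ be built from the limits, and suppose that $\widetilde E$ and all $\sigma_i\widetilde E-\widetilde A$ are nonsingular. Then the reduced model $\widetilde G(s)=\widetilde C(s\widetilde E-\widetilde A)^{-1}\widetilde B+\widetilde D$ satisfies the first-order necessary conditions of the $\mathcal H_2$-optimal model reduction problem, that is: 1. $G$ and $\widetilde G$ have the same polynomial part; 2. the pencil $s\widetilde E-\widetilde A$ has $r$ distinct eigenvalues $\widetilde\lambda_1,\dots,\widetilde\lambda_r$, and for all right and left eigenvectors $z_i,y_i$ with $\widetilde Az_i=\widetilde\lambda_i\widetilde Ez_i$, $y_i^*\widetilde A=\widetilde\lambda_iy_i^*\widetilde E$, $y_i^*\widetilde Ez_j=\delta_{ij}$, the vectors $\widetilde{\mathsf b}_i^T=y_i^*\widetilde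 B$ and $\widetilde{\mathsf c}_i=\widetilde Cz_i$ are nonzero, $-\widetilde\lambda_iE-A$ and $-\widetilde\lambda_i\widetilde E-\widetilde A$ are nonsingular, and for $i=1,\dots,r$ $$G(-\widetilde\lambda_i)\widetilde{\mathsf b}_i=\widetilde G(-\widetilde\lambda_i)\widetilde{\mathsf b}_i,\qquad \widetilde{\mathsf c}_i^TG(-\widetilde\lambda_i)=\widetilde{\mathsf c}_i^T\widetilde G(-\widetilde\lambda_i),\qquad \widetilde{\mathsf c}_i^TG'(-\widetilde\lambda_i)\widetilde{\mathsf b}_i=\widetilde{\mathsf c}_i^T\widetilde G'(-\widetilde\lambda_i)\widetilde{\mathsf b}_i .$$ -/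

import Mathlib

open Matrix Filter Topology

namespace DescriptorH2

noncomputable section

/-- A (complex) descriptor model `E x' = A x + B u`, `y = C x + D u` with state index set `ι`,
`m` inputs and `p` outputs. -/
structure Model (ι : Type) (m p : ℕ) where
  E : Matrix ι ι ℂ
  A : Matrix ι ι ℂ
  B : Matrix ι (Fin m) ℂ
  C : Matrix (Fin p) ι ℂ
  D : Matrix (Fin p) (Fin m) ℂ

namespace Model

variable {ι : Type} [Fintype ι] [DecidableEq ι] {m p : ℕ}

/-- The pencil `s E - A`. -/
def pencil (M : Model ι m p) (s : ℂ) : Matrix ι ι ℂ := s • M.E - M.A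

/-- `s E - A` is nonsingular. -/
def RegularAt (M : Model ι m p) (s : ℂ) : Prop := IsUnit (M.pencil s).det

/-- The transfer function `G(s) = C (s E - A)⁻¹ B + D`. -/
def transfer (M : Model ι m p) (s : ℂ) : Matrix (Fin p) (Fin m) ℂ :=
  M.C * (M.pencil s)⁻¹ * M.B + M.D

/-- The (entrywise) complex derivative `G'(s)` of the transfer function. -/
def transferDeriv (M : Model ι m p) (s : ℂ) : Matrix (Fin p) (Fin m) ℂ :=
  Matrix.of fun i j => deriv (fun t => M.transfer t i j) s

end Model

/-- The polynomial matrix `P` is the polynomial part of the matrix function `G`: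
the remainder `G - P` is strictly proper, that is, it tends to `0` as `s → ∞`. -/
def IsPolynomialPart {m p : ℕ} (G : ℂ → Matrix (Fin p) (Fin m) ℂ)
    (P : Matrix (Fin p) (Fin m) (Polynomial ℂ)) : Prop :=
  Tendsto (fun s => G s - P.map (Polynomial.eval s)) (cocompact ℂ) (𝓝 0)

/-- `lam` lists `r` distinct eigenvalues of the pencil `s E - A` of size `r`, with right
eigenvectors `z i` and left eigenvectors `y i`, normalized by `(y i)^* E (z j) = δ_ij`. -/
structure IsSpectralData {m p r : ℕ} (R : Model (Fin r) m p)
    (lam : Fin r → ℂ) (y z : Fin r → Fin r → ℂ) : Prop where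
  distinct : Function.Injective lam
  right : ∀ i, R.A *ᵥ z i = lam i • (R.E *ᵥ z i)
  left : ∀ i, star (y i) ᵥ* R.A = lam i • (star (y i) ᵥ* R.E)
  biorthonormal : ∀ i j, star (y i) ⬝ᵥ (R.E *ᵥ z j) = if i = j then 1 else 0

/-- The first-order necessary conditions for `R` to be an `H₂`-optimal reduced model of order `r`
of `G`: the polynomial parts agree and, at the mirror images of the poles of the reduced model
(assumed simple), the reduced transfer function is a bi-tangential Hermite interpolant of the full
one along the residue directions. The matrix `E` of `R` is nonsingular, so that
`C (s E - A)⁻¹ B` is the strictly proper part of `R`; it has order exactly `r` since the residue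
directions do not vanish. -/
structure SatisfiesH2NecessaryConditions {ι : Type} [Fintype ι] [DecidableEq ι] {m p r : ℕ}
    (G : Model ι m p) (R : Model (Fin r) m p) : Prop where
  nonsingular : IsUnit R.E.det
  polynomialPart : ∃ P : Matrix (Fin p) (Fin m) (Polynomial ℂ),
    IsPolynomialPart G.transfer P ∧ IsPolynomialPart R.transfer P
  simplePoles : ∃ lam y z, IsSpectralData R lam y z
  interpolation : ∀ lam y z, IsSpectralData R lam y z → ∀ i : Fin r,
    let b : Fin m → ℂ := star (y i) ᵥ* R.B
    let c : Fin p → ℂ := R.C *ᵥ z i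
    b ≠ 0 ∧ c ≠ 0 ∧ G.RegularAt (-lam i) ∧ R.RegularAt (-lam i) ∧
    G.transfer (-lam i) *ᵥ b = R.transfer (-lam i) *ᵥ b ∧
    c ᵥ* G.transfer (-lam i) = c ᵥ* R.transfer (-lam i) ∧
    c ⬝ᵥ (G.transferDeriv (-lam i) *ᵥ b) = c ⬝ᵥ (R.transferDeriv (-lam i) *ᵥ b)

/-- The semi-explicit descriptor system
`E₁₁ x₁' + E₁₂ x₂' = A₁₁ x₁ + A₁₂ x₂ + B₁ u`, `0 = A₂₁ x₁ + A₂₂ x₂ + B₂ u`,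
`y = C₁ x₁ + C₂ x₂ + D u` with real coefficients. -/
structure SemiExplicitSystem (n₁ n₂ m p : ℕ) where
  E₁₁ : Matrix (Fin n₁) (Fin n₁) ℝ
  E₁₂ : Matrix (Fin n₁) (Fin n₂) ℝ
  A₁₁ : Matrix (Fin n₁) (Fin n₁) ℝ
  A₁₂ : Matrix (Fin n₁) (Fin n₂) ℝ
  A₂₁ : Matrix (Fin n₂) (Fin n₁) ℝ
  A₂₂ : Matrix (Fin n₂) (Fin n₂) ℝ
  B₁ : Matrix (Fin n₁) (Fin m) ℝ
  B₂ : Matrix (Fin n₂) (Fin m) ℝ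
  C₁ : Matrix (Fin p) (Fin n₁) ℝ
  C₂ : Matrix (Fin p) (Fin n₂) ℝ
  D : Matrix (Fin p) (Fin m) ℝ

/-- The variables of the iteration: shifts `σ i`, right tangential directions `b i` and left
tangential directions `c i`, for `i = 1, …, r`. -/
structure IRKAData (r m p : ℕ) where
  σ : Fin r → ℂ
  b : Fin r → Fin m → ℂ
  c : Fin r → Fin p → ℂ

namespace IRKAData

variable {r m p : ℕ}

/-- The matrix `[b₁, …, b_r]`. -/
def bMatrix (d : IRKAData r m p) : Matrix (Fin m) (Fin r) ℂ := Matrix.of fun j i => d.b i j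

/-- The matrix `[c₁, …, c_r]`. -/
def cMatrix (d : IRKAData r m p) : Matrix (Fin p) (Fin r) ℂ := Matrix.of fun j i => d.c i j

/-- Convergence of the shifts and of the tangential directions. -/
def ConvergesTo (d : ℕ → IRKAData r m p) (l : IRKAData r m p) : Prop :=
  Tendsto (fun k => (d k).σ) atTop (𝓝 l.σ) ∧ Tendsto (fun k => (d k).b) atTop (𝓝 l.b) ∧
    Tendsto (fun k => (d k).c) atTop (𝓝 l.c)

end IRKAData

namespace SemiExplicitSystem

variable {n₁ n₂ m p r : ℕ}

/-- `E₁₁ - E₁₂ A₂₂⁻¹ A₂₁`. -/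
def schur (S : SemiExplicitSystem n₁ n₂ m p) : Matrix (Fin n₁) (Fin n₁) ℝ :=
  S.E₁₁ - S.E₁₂ * S.A₂₂⁻¹ * S.A₂₁

/-- The index-1 condition: `A₂₂` and `E₁₁ - E₁₂ A₂₂⁻¹ A₂₁` are nonsingular. -/
def IsIndexOne (S : SemiExplicitSystem n₁ n₂ m p) : Prop :=
  IsUnit S.A₂₂.det ∧ IsUnit S.schur.det

/-- `M₁ = (E₁₁ - E₁₂ A₂₂⁻¹ A₂₁)⁻¹ E₁₂ A₂₂⁻¹`. -/
def M₁ (S : SemiExplicitSystem n₁ n₂ m p) : Matrix (Fin n₁) (Fin n₂) ℝ :=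
  S.schur⁻¹ * S.E₁₂ * S.A₂₂⁻¹

/-- `M₂ = - A₂₂⁻¹ A₂₁ (E₁₁ - E₁₂ A₂₂⁻¹ A₂₁)⁻¹ E₁₂ A₂₂⁻¹ - A₂₂⁻¹`. -/
def M₂ (S : SemiExplicitSystem n₁ n₂ m p) : Matrix (Fin n₂) (Fin n₂) ℝ :=
  -(S.A₂₂⁻¹ * S.A₂₁ * S.schur⁻¹ * S.E₁₂ * S.A₂₂⁻¹) - S.A₂₂⁻¹

/-- The feedthrough matrix `C₁ M₁ B₂ + C₂ M₂ B₂ + D` of the reduced model. -/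
def reducedD (S : SemiExplicitSystem n₁ n₂ m p) : Matrix (Fin p) (Fin m) ℂ :=
  (S.C₁ * S.M₁ * S.B₂ + S.C₂ * S.M₂ * S.B₂ + S.D).map Complex.ofReal

/-- The full system as a descriptor model with block state `(x₁, x₂)`, over the complex numbers. -/
def toModel (S : SemiExplicitSystem n₁ n₂ m p) : Model (Fin n₁ ⊕ Fin n₂) m p where
  E := (Matrix.fromBlocks S.E₁₁ S.E₁₂ 0 0).map Complex.ofReal
  A := (Matrix.fromBlocks S.A₁₁ S.A₁₂ S.A₂₁ S.A₂₂).map Complex.ofReal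
  B := (Matrix.fromRows S.B₁ S.B₂).map Complex.ofReal
  C := (Matrix.fromCols S.C₁ S.C₂).map Complex.ofReal
  D := S.D.map Complex.ofReal

/-- The amount by which the feedthrough matrix changes, reduced minus full; this is
`C₁ M₁ B₂ + C₂ M₂ B₂`, and it equals the feedthrough matrix of the reduced model if `D = 0`. -/
def shiftD (S : SemiExplicitSystem n₁ n₂ m p) : Matrix (Fin p) (Fin m) ℂ :=
  S.reducedD - S.toModel.D

/-- `V = [(σ₁ E - A)⁻¹ B b₁, …, (σ_r E - A)⁻¹ B b_r]`. -/
def V (S : SemiExplicitSystem n₁ n₂ m p) (d : IRKAData r m p) :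
    Matrix (Fin n₁ ⊕ Fin n₂) (Fin r) ℂ :=
  Matrix.of fun k i => ((S.toModel.pencil (d.σ i))⁻¹ *ᵥ (S.toModel.B *ᵥ d.b i)) k

/-- `W = [(σ₁ E - A)⁻ᵀ Cᵀ c₁, …, (σ_r E - A)⁻ᵀ Cᵀ c_r]`. -/
def W (S : SemiExplicitSystem n₁ n₂ m p) (d : IRKAData r m p) :
    Matrix (Fin n₁ ⊕ Fin n₂) (Fin r) ℂ :=
  Matrix.of fun k i => ((S.toModel.pencil (d.σ i))⁻¹ᵀ *ᵥ (S.toModel.Cᵀ *ᵥ d.c i)) k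

/-- The reduced model with shifted feedthrough built from the interpolation data `d`. -/
def reducedModel (S : SemiExplicitSystem n₁ n₂ m p) (d : IRKAData r m p) :
    Model (Fin r) m p where
  E := (S.W d)ᵀ * S.toModel.E * S.V d
  A := (S.W d)ᵀ * S.toModel.A * S.V d + d.cMatrixᵀ * S.shiftD * d.bMatrix
  B := (S.W d)ᵀ * S.toModel.B - d.cMatrixᵀ * S.shiftD
  C := S.toModel.C * S.V d - S.shiftD * d.bMatrix
  D := S.reducedD

/-- `d'` is a possible result of one pass through the loop, started at `d`. The linear systems
for `V` and `W` are solvable, `Y^* A Z = diag(lam)` and `Y^* E Z = I` for the reduced model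
`(E, A, B, C)` of `d`, and `σ i ← -lam i`, `(b i)ᵀ ← (y i)^* B`, `c i ← C (z i)`, where `y i`, `z i`
are the columns of `Y`, `Z`. It is a relation since the eigenvectors and their numbering are not
unique. -/
def IRKAStep (S : SemiExplicitSystem n₁ n₂ m p) (d d' : IRKAData r m p) : Prop :=
  (∀ i, S.toModel.RegularAt (d.σ i)) ∧
  ∃ (lam : Fin r → ℂ) (Y Z : Matrix (Fin r) (Fin r) ℂ),
    Yᴴ * (S.reducedModel d).A * Z = Matrix.diagonal lam ∧
    Yᴴ * (S.reducedModel d).E * Z = 1 ∧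
    ∀ i, d'.σ i = -lam i ∧
      d'.b i = star (fun k => Y k i) ᵥ* (S.reducedModel d).B ∧
      d'.c i = (S.reducedModel d).C *ᵥ (fun k => Z k i)

end SemiExplicitSystem

end

end DescriptorH2

open Matrix Filter Topology

namespace DescriptorH2

noncomputable section

/-! ### Rank-one matrices, adjugates and simultaneously diagonalized pencils. -/

section MatrixLemmas

/-! The matrices `Y`, `Z` of the steps need not converge, so the limit is taken in identities free
of them. The determinant `det (s E - A) = det E * ∏ (s - λ_j)` and the adjugate of the pencil at
`λ_i`, a multiple of `z_i y_i^*`, turn each step into polynomial identities in the reduced matrices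
and the new data (`det_limit_pencil`, `adjugate_limit_pencil`). In the limit the poles are the
numbers `-σ_i`, and up to a nonzero factor the residue there is `c_i b_iᵀ`. Hence the residue
directions of any normalized eigenvectors are multiples of `b_i` and `c_i`, which are nonzero
because the reduced `E` is nonsingular. The construction from `V` and `W` gives Hermite
interpolation at `σ_i` along `b_i`, `c_i` for any feedthrough shift (`transfer_mulVec_eq`,
`vecMul_transfer_eq`, `transferDeriv_bilinear_eq`). The chosen shift makes the two values at
infinity agree (`tendsto_transfer`). -/

theorem tendsto_matrix_mul {α R ι κ l : Type*} [Fintype κ] [NonUnitalNonAssocSemiring R] [TopologicalSpace R]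
    [ContinuousAdd R] [ContinuousMul R] {f : Filter α} {A : α → Matrix ι κ R} {B : α → Matrix κ l R}
    {A₀ : Matrix ι κ R} {B₀ : Matrix κ l R} (hA : Tendsto A f (𝓝 A₀)) (hB : Tendsto B f (𝓝 B₀)) :
    Tendsto (fun x => A x * B x) f (𝓝 (A₀ * B₀)) :=
  (((continuous_fst (X := Matrix ι κ R) (Y := Matrix κ l R)).matrix_mul
    continuous_snd).tendsto (A₀, B₀)).comp (hA.prodMk_nhds hB)

theorem mul_vecMulVec_mul {ι m p : Type*} [Fintype ι] (C : Matrix p ι ℂ) (B : Matrix ι m ℂ) (z y : ι → ℂ) :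
    C * vecMulVec z y * B = vecMulVec (C *ᵥ z) (y ᵥ* B) := by
  rw [mul_vecMulVec, vecMulVec_mul]

/-- A nonzero rank-one matrix determines its factors up to scalars. A single nonzero entry already
forces `y`, `b'`, `c'` to be nonzero. -/
theorem exists_smul_of_vecMulVec_eq {m p : Type*} {c c' : p → ℂ} {b b' : m → ℂ} {x y : ℂ}
    (hx : x ≠ 0) (hc : c ≠ 0) (hb : b ≠ 0)
    (h : x • vecMulVec c b = y • vecMulVec c' b') :
    b' ≠ 0 ∧ c' ≠ 0 ∧ (∃ u : ℂ, b' = u • b) ∧ ∃ v : ℂ, c' = v • c := by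
  have h' : ∀ i j, x * (c i * b j) = y * (c' i * b' j) := fun i j => by
    simpa [vecMulVec_apply] using congrFun (congrFun h i) j
  obtain ⟨i, hi⟩ := Function.ne_iff.1 hc
  obtain ⟨j, hj⟩ := Function.ne_iff.1 hb
  simp only [Pi.zero_apply] at hi hj
  have hij : y * (c' i * b' j) ≠ 0 := by
    rw [← h']; exact mul_ne_zero hx (mul_ne_zero hi hj)
  have hy := left_ne_zero_of_mul hij
  have hci := left_ne_zero_of_mul (right_ne_zero_of_mul hij)
  have hbj := right_ne_zero_of_mul (right_ne_zero_of_mul hij)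
  refine ⟨fun e => hbj (by simp [e]), fun e => hci (by simp [e]),
    ⟨x * c i / (y * c' i), ?_⟩, ⟨x * b j / (y * b' j), ?_⟩⟩
  · ext k
    have := h' i k
    simp only [Pi.smul_apply, smul_eq_mul]
    field_simp
    linear_combination -this
  · ext k
    have := h' k j
    simp only [Pi.smul_apply, smul_eq_mul]
    field_simp
    linear_combination -this

variable {ι : Type*} [Fintype ι] [DecidableEq ι]

theorem tendsto_matrix_inv {α : Type*} {f : Filter α} {A : α → Matrix ι ι ℂ} {A₀ : Matrix ι ι ℂ}
    (hA : Tendsto A f (𝓝 A₀)) (h₀ : IsUnit A₀.det) : Tendsto (fun x => (A x)⁻¹) f (𝓝 A₀⁻¹) := by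
  refine Tendsto.comp (continuousAt_matrix_inv A₀ ?_) hA
  simpa [Ring.inverse_eq_inv'] using continuousAt_inv₀ h₀.ne_zero

theorem adjugate_diagonal_eq (v : ι → ℂ) :
    (diagonal v).adjugate = diagonal fun i => ∏ j ∈ Finset.univ.erase i, v j := by
  ext i j
  rw [adjugate_apply]
  by_cases h : i = j
  · subst h
    have : (diagonal v).updateRow i (Pi.single i 1) = diagonal (Function.update v i 1) := by
      ext a b
      by_cases ha : a = i
      · subst ha
        by_cases hb : b = a
        · subst hb; simp
        · simp [hb, Ne.symm hb]
      · by_cases hab : a = b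
        · subst hab; simp [ha]
        · simp [ha, hab]
    rw [this, det_diagonal, diagonal_apply_eq, Finset.prod_update_of_mem (Finset.mem_univ i),
      one_mul, Finset.sdiff_singleton_eq_erase]
  · rw [diagonal_apply_ne _ h]
    refine det_eq_zero_of_column_eq_zero j fun k => ?_
    by_cases hk : k = j
    · subst hk; simp [Ne.symm h]
    · simp [hk]

variable {X Z A E : Matrix ι ι ℂ} {lam : ι → ℂ}

theorem mul_pencil_mul_eq_diagonal (hA : X * A * Z = diagonal lam) (hE : X * E * Z = 1) (s : ℂ) :
    X * (s • E - A) * Z = diagonal fun j => s - lam j := by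
  have : diagonal (fun j => s - lam j) = s • (1 : Matrix ι ι ℂ) - diagonal lam := by
    rw [← diagonal_one, ← diagonal_smul, diagonal_sub]; congr 1; ext; simp
  rw [this, ← hA, ← hE]
  simp [Matrix.mul_sub, Matrix.sub_mul]

/-- The determinant of a simultaneously diagonalized pencil. -/
theorem det_pencil_of_diagonalized (hA : X * A * Z = diagonal lam) (hE : X * E * Z = 1) (s : ℂ) :
    (s • E - A).det = E.det * ∏ j, (s - lam j) := by
  have h1 := congrArg det (mul_pencil_mul_eq_diagonal hA hE s)
  have h2 := congrArg det hE
  simp only [det_mul, det_diagonal, det_one] at h1 h2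
  rw [← h1]
  linear_combination (-(s • E - A).det) * h2

/-- The adjugate of a simultaneously diagonalized pencil at one of its eigenvalues. -/
theorem adjugate_pencil_of_diagonalized (hA : X * A * Z = diagonal lam) (hE : X * E * Z = 1)
    (i : ι) :
    (lam i • E - A).adjugate = (E.det * ∏ j ∈ Finset.univ.erase i, (lam i - lam j)) •
      vecMulVec (fun k => Z k i) (X i) := by
  have h1 := congrArg adjugate (mul_pencil_mul_eq_diagonal hA hE (lam i))
  have h2 := congrArg det hE
  simp only [det_mul, det_one] at h2
  rw [adjugate_mul_distrib, adjugate_mul_distrib, adjugate_diagonal_eq] at h1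
  -- Multiplying `adj Z * adj P * adj X` by `Z` on the left and `X` on the right cancels the outer
  -- adjugates up to determinants.
  have h3 : (Z.det * X.det) • (lam i • E - A).adjugate =
      Z * (diagonal fun k => ∏ j ∈ Finset.univ.erase k, (lam i - lam j)) * X := by
    rw [← h1]
    calc _ = (Z.det • (1 : Matrix ι ι ℂ)) * (lam i • E - A).adjugate * (X.det • 1) := by
          simp [smul_smul, mul_comm]
      _ = _ := by rw [← mul_adjugate, ← adjugate_mul]; simp only [Matrix.mul_assoc]
  have h4 : Z * (diagonal fun k => ∏ j ∈ Finset.univ.erase k, (lam i - lam j)) * X =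
      (∏ j ∈ Finset.univ.erase i, (lam i - lam j)) • vecMulVec (fun k => Z k i) (X i) := by
    ext a b
    rw [Matrix.mul_apply, Finset.sum_eq_single i]
    · simp [vecMulVec_apply]; ring
    -- For `k ≠ i` the product over `j ≠ k` contains the vanishing factor `j = i`.
    · intro k _ hk
      rw [mul_diagonal, Finset.prod_eq_zero (i := i) (by simp [Ne.symm hk]) (sub_self _)]
      simp
    · simp
  calc (lam i • E - A).adjugate = (E.det * (Z.det * X.det)) • (lam i • E - A).adjugate := by
        rw [show E.det * (Z.det * X.det) = 1 by linear_combination h2, one_smul]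
    _ = _ := by rw [mul_smul, h3, h4, smul_smul]

end MatrixLemmas

/-! ### Transfer functions: derivative, tangential values, value at infinity. -/

namespace Model

theorem continuous_pencil {ι : Type} {m p : ℕ} (M : Model ι m p) : Continuous M.pencil :=
  (continuous_id.smul continuous_const).sub continuous_const

variable {ι : Type} [Fintype ι] [DecidableEq ι] {m p : ℕ}

/-- The derivative of the transfer function is `-C (s E - A)⁻¹ E (s E - A)⁻¹ B`. -/
theorem transferDeriv_eq (M : Model ι m p) {s : ℂ} (hs : M.RegularAt s) :
    M.transferDeriv s = -(M.C * (M.pencil s)⁻¹ * M.E * (M.pencil s)⁻¹ * M.B) := by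
  have hinv : Tendsto (fun t => (M.pencil t)⁻¹) (𝓝 s) (𝓝 (M.pencil s)⁻¹) :=
    tendsto_matrix_inv (M.continuous_pencil.tendsto s) hs
  have hreg : ∀ᶠ t in 𝓝 s, M.RegularAt t := by
    have : Tendsto (fun t => (M.pencil t).det) (𝓝 s) (𝓝 (M.pencil s).det) :=
      M.continuous_pencil.matrix_det.tendsto s
    filter_upwards [this.eventually_ne hs.ne_zero] with t ht using isUnit_iff_ne_zero.2 ht
  ext i j
  refine HasDerivAt.deriv ?_
  rw [hasDerivAt_iff_tendsto_slope]
  have hlim : Tendsto (fun t => (-(M.C * (M.pencil t)⁻¹ * M.E * (M.pencil s)⁻¹ * M.B)) i j)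
      (𝓝[≠] s) (𝓝 ((-(M.C * (M.pencil s)⁻¹ * M.E * (M.pencil s)⁻¹ * M.B)) i j)) := by
    have := (tendsto_matrix_mul (tendsto_matrix_mul (tendsto_matrix_mul
      (tendsto_matrix_mul (tendsto_const_nhds (x := M.C)) hinv) (tendsto_const_nhds (x := M.E)))
      (tendsto_const_nhds (x := (M.pencil s)⁻¹))) (tendsto_const_nhds (x := M.B))).neg
    exact (tendsto_pi_nhds.1 (tendsto_pi_nhds.1 this i) j).mono_left nhdsWithin_le_nhds
  refine hlim.congr' ?_
  filter_upwards [hreg.filter_mono nhdsWithin_le_nhds, self_mem_nhdsWithin] with t ht hts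
  have hts' : t - s ≠ 0 := sub_ne_zero.2 hts
  -- The resolvent identity; it makes the difference quotient an exact expression in `(M.pencil
  -- t)⁻¹`, so continuity of inversion suffices.
  have hres : (M.pencil t)⁻¹ - (M.pencil s)⁻¹ =
      -((t - s) • ((M.pencil t)⁻¹ * M.E * (M.pencil s)⁻¹)) := by
    have hp : (t - s) • M.E = M.pencil t - M.pencil s := by
      simp [pencil, sub_smul]
    calc _ = -((M.pencil t)⁻¹ * (M.pencil t - M.pencil s) * (M.pencil s)⁻¹) := by
          rw [Matrix.mul_sub, nonsing_inv_mul _ ht, Matrix.sub_mul, Matrix.mul_assoc _ _ (_)⁻¹,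
            mul_nonsing_inv _ hs]
          simp
      _ = _ := by rw [← hp]; simp
  have hdiff : M.transfer t - M.transfer s =
      (t - s) • -(M.C * (M.pencil t)⁻¹ * M.E * (M.pencil s)⁻¹ * M.B) := by
    calc _ = M.C * ((M.pencil t)⁻¹ - (M.pencil s)⁻¹) * M.B := by
          simp [transfer, Matrix.mul_sub, Matrix.sub_mul]
      _ = _ := by rw [hres]; simp [Matrix.mul_assoc]
  have := congrFun (congrFun hdiff i) j
  rw [slope_def_field, eq_div_iff hts']
  simp only [Matrix.sub_apply, Matrix.smul_apply, smul_eq_mul] at this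
  rw [this, mul_comm]

variable {M : Model ι m p} {s : ℂ} {x w : ι → ℂ} {b : Fin m → ℂ} {c : Fin p → ℂ}

theorem inv_pencil_mulVec (hs : M.RegularAt s) (hx : M.pencil s *ᵥ x = M.B *ᵥ b) :
    (M.pencil s)⁻¹ *ᵥ (M.B *ᵥ b) = x := by
  rw [← hx, mulVec_mulVec, nonsing_inv_mul _ hs, one_mulVec]

theorem vecMul_inv_pencil (hs : M.RegularAt s) (hw : w ᵥ* M.pencil s = c ᵥ* M.C) :
    (c ᵥ* M.C) ᵥ* (M.pencil s)⁻¹ = w := by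
  rw [← hw, vecMul_vecMul, mul_nonsing_inv _ hs, vecMul_one]

theorem transfer_mulVec (hs : M.RegularAt s) (hx : M.pencil s *ᵥ x = M.B *ᵥ b) :
    M.transfer s *ᵥ b = M.C *ᵥ x + M.D *ᵥ b := by
  rw [transfer, add_mulVec, ← mulVec_mulVec, ← mulVec_mulVec, inv_pencil_mulVec hs hx]

theorem vecMul_transfer (hs : M.RegularAt s) (hw : w ᵥ* M.pencil s = c ᵥ* M.C) :
    c ᵥ* M.transfer s = w ᵥ* M.B + c ᵥ* M.D := by
  rw [transfer, vecMul_add, ← vecMul_vecMul, ← vecMul_vecMul, vecMul_inv_pencil hs hw]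

theorem dotProduct_transferDeriv_mulVec (hs : M.RegularAt s) (hx : M.pencil s *ᵥ x = M.B *ᵥ b)
    (hw : w ᵥ* M.pencil s = c ᵥ* M.C) :
    c ⬝ᵥ (M.transferDeriv s *ᵥ b) = -(w ⬝ᵥ (M.E *ᵥ x)) := by
  rw [transferDeriv_eq M hs, neg_mulVec, dotProduct_neg, ← mulVec_mulVec, ← mulVec_mulVec,
    inv_pencil_mulVec hs hx, ← mulVec_mulVec, ← mulVec_mulVec, dotProduct_mulVec,
    dotProduct_mulVec, vecMul_inv_pencil hs hw]

/-- The value at infinity of the transfer function of a model of index one, where `K` is a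
projection that annihilates `E`. -/
theorem tendsto_transfer_cocompact (M : Model ι m p) (K : Matrix ι ι ℂ) (hK : K * K = K)
    (hKE : K * M.E = 0) (hdet : IsUnit (M.E - K * M.A).det) :
    Tendsto M.transfer (cocompact ℂ) (𝓝 (M.C * (M.E - K * M.A)⁻¹ * (K * M.B) + M.D)) := by
  -- `L s⁻¹` divides the differential part of the pencil by `s` and keeps the algebraic part. Since
  -- `K * E = 0`, the product `L s⁻¹ * (s E - A)` is `N s⁻¹`, which has an invertible limit at
  -- infinity.
  set L : ℂ → Matrix ι ι ℂ := fun t => t • (1 - K) + K with hL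
  set N : ℂ → Matrix ι ι ℂ := fun t => M.E - K * M.A - t • ((1 - K) * M.A) with hN
  have hLc : Continuous L := (continuous_id.smul continuous_const).add continuous_const
  have hNc : Continuous N := continuous_const.sub (continuous_id.smul continuous_const)
  have hN0 : N 0 = M.E - K * M.A := by simp [hN]
  have hL0 : L 0 = K := by simp [hL]
  have hinv : Tendsto (fun s : ℂ => s⁻¹) (cocompact ℂ) (𝓝 0) := by
    rw [← Metric.cobounded_eq_cocompact]
    exact tendsto_inv₀_cobounded
  have hNt : Tendsto (fun s : ℂ => (N s⁻¹)⁻¹) (cocompact ℂ) (𝓝 (M.E - K * M.A)⁻¹) :=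
    tendsto_matrix_inv (hN0 ▸ (hNc.tendsto 0).comp hinv) hdet
  have hLt : Tendsto (fun s : ℂ => L s⁻¹) (cocompact ℂ) (𝓝 K) :=
    hL0 ▸ (hLc.tendsto 0).comp hinv
  have key := (tendsto_matrix_mul (tendsto_matrix_mul (tendsto_const_nhds (x := M.C)) hNt)
    (tendsto_matrix_mul hLt (tendsto_const_nhds (x := M.B)))).add (tendsto_const_nhds (x := M.D))
  refine key.congr' ?_
  filter_upwards [(Set.finite_singleton (0 : ℂ)).isCompact.compl_mem_cocompact] with s hs'
  have hs : s ≠ 0 := hs'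
  have hLP : L s⁻¹ * M.pencil s = N s⁻¹ := by
    simp only [hL, hN, pencil, Matrix.add_mul, Matrix.mul_sub, Matrix.sub_mul, Matrix.smul_mul,
      Matrix.mul_smul, hKE, Matrix.one_mul, smul_sub, smul_zero, sub_zero,
      add_zero, smul_inv_smul₀ hs]
    abel
  have hLL : L s⁻¹ * (s • (1 - K) + K) = 1 := by
    simp only [hL, Matrix.add_mul, Matrix.mul_add, Matrix.mul_sub, Matrix.sub_mul, Matrix.smul_mul,
      Matrix.mul_smul, hK, Matrix.one_mul, Matrix.mul_one, smul_sub, smul_add,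
      smul_inv_smul₀ hs]
    abel
  have hLu : IsUnit (L s⁻¹).det := isUnit_det_of_right_inverse hLL
  have : (N s⁻¹)⁻¹ * L s⁻¹ = (M.pencil s)⁻¹ := by
    rw [← hLP, Matrix.mul_inv_rev, Matrix.mul_assoc, nonsing_inv_mul _ hLu, Matrix.mul_one]
  simp only [transfer, ← this, Matrix.mul_assoc]

theorem isPolynomialPart_of_tendsto {G : ℂ → Matrix (Fin p) (Fin m) ℂ}
    {D : Matrix (Fin p) (Fin m) ℂ} (h : Tendsto G (cocompact ℂ) (𝓝 D)) :
    IsPolynomialPart G (D.map Polynomial.C) := by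
  have : ∀ s : ℂ, (D.map Polynomial.C).map (Polynomial.eval s) = D := fun s => by ext; simp
  simpa [IsPolynomialPart, this] using h.sub (tendsto_const_nhds (x := D))

end Model

/-! ### Spectral data of a pencil. -/

/-- The simultaneous diagonalization that spectral data provide. -/
theorem IsSpectralData.diagonalize {m p r : ℕ} {R : Model (Fin r) m p} {lam : Fin r → ℂ}
    {y z : Fin r → Fin r → ℂ} (h : IsSpectralData R lam y z) :
    Matrix.of (fun i => star (y i)) * R.A * (Matrix.of z)ᵀ = diagonal lam ∧
      Matrix.of (fun i => star (y i)) * R.E * (Matrix.of z)ᵀ = 1 := by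
  have hE : Matrix.of (fun i => star (y i)) * R.E * (Matrix.of z)ᵀ = 1 := by
    ext i j
    rw [Matrix.mul_assoc, Matrix.one_apply, ← h.biorthonormal i j]
    rfl
  refine ⟨?_, hE⟩
  have hAz : R.A * (Matrix.of z)ᵀ = R.E * (Matrix.of z)ᵀ * diagonal lam := by
    ext i j
    rw [mul_diagonal, mul_comm]
    exact congrFun (h.right j) i
  rw [Matrix.mul_assoc, hAz, ← Matrix.mul_assoc, ← Matrix.mul_assoc, hE, Matrix.one_mul]

/-- A pencil of size `r` with nonsingular `E` and `r` distinct eigenvalues has spectral data. -/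
theorem exists_isSpectralData {m p r : ℕ} (R : Model (Fin r) m p) (hE : IsUnit R.E.det)
    (lam : Fin r → ℂ) (hlam : Function.Injective lam) (hdet : ∀ i, (R.pencil (lam i)).det = 0) :
    ∃ y z, IsSpectralData R lam y z := by
  choose z hz0 hz using fun i => exists_mulVec_eq_zero_iff.2 (hdet i)
  have hz' : ∀ i, R.A *ᵥ z i = lam i • (R.E *ᵥ z i) := fun i => by
    have := hz i
    rw [Model.pencil, sub_mulVec, smul_mulVec, sub_eq_zero] at this
    exact this.symm
  set Z : Matrix (Fin r) (Fin r) ℂ := (Matrix.of z)ᵀ with hZ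
  have hli : LinearIndependent ℂ z := by
    refine Module.End.eigenvectors_linearIndependent' (R.E⁻¹ * R.A).mulVecLin lam hlam z
      fun i => ⟨Module.End.mem_eigenspace_iff.2 ?_, hz0 i⟩
    rw [mulVecLin_apply, ← mulVec_mulVec, hz', mulVec_smul, mulVec_mulVec,
      nonsing_inv_mul _ hE, one_mulVec]
  have hZu : IsUnit Z := by
    rw [← linearIndependent_cols_iff_isUnit]
    exact hli
  have hEZ : IsUnit (R.E * Z).det := by
    rw [det_mul]; exact hE.mul ((isUnit_iff_isUnit_det _).1 hZu)
  -- The rows of `X` are the left eigenvectors, already normalized against the columns of `Z`.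
  set X := (R.E * Z)⁻¹ with hX
  have hXE : X * R.E * Z = 1 := by rw [Matrix.mul_assoc, hX, nonsing_inv_mul _ hEZ]
  have hAZ : R.A * Z = R.E * Z * diagonal lam := by
    ext i j
    rw [mul_diagonal, mul_comm]
    exact congrFun (hz' j) i
  have hZX : Z * (X * R.E) = 1 := mul_eq_one_comm.1 hXE
  have hXA : X * R.A = diagonal lam * (X * R.E) := by
    calc X * R.A = X * (R.A * Z) * (X * R.E) := by
          rw [← Matrix.mul_assoc X, Matrix.mul_assoc (X * R.A), hZX, Matrix.mul_one]
      _ = _ := by rw [hAZ, ← Matrix.mul_assoc X, ← Matrix.mul_assoc X, hXE, Matrix.one_mul]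
  refine ⟨fun i => star (X i), z, hlam, hz', fun i => ?_, fun i j => ?_⟩
  · rw [star_star]
    ext j
    have := congrFun (congrFun hXA i) j
    rwa [diagonal_mul] at this
  · rw [star_star, ← Matrix.one_apply, ← hXE, Matrix.mul_assoc]
    rfl

/-! ### The semi-explicit system at infinity. -/

namespace SemiExplicitSystem

variable {n₁ n₂ m p r : ℕ} (S : SemiExplicitSystem n₁ n₂ m p)

/-- The block matrix `[E₁₁, E₁₂; -A₂₁, -A₂₂]`, which governs the model at infinity. -/
def infinityMatrix : Matrix (Fin n₁ ⊕ Fin n₂) (Fin n₁ ⊕ Fin n₂) ℝ :=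
  fromBlocks S.E₁₁ S.E₁₂ (-S.A₂₁) (-S.A₂₂)

variable {S}

theorem isUnit_det_infinityMatrix (h : S.IsIndexOne) : IsUnit S.infinityMatrix.det := by
  have h2 : (-S.A₂₂⁻¹) * (-S.A₂₂) = 1 := by
    rw [Matrix.neg_mul, Matrix.mul_neg, neg_neg, nonsing_inv_mul _ h.1]
  let : Invertible (-S.A₂₂) := ⟨-S.A₂₂⁻¹, h2, mul_eq_one_comm.1 h2⟩
  rw [infinityMatrix, det_fromBlocks₂₂]
  refine (isUnit_det_of_left_inverse h2).mul ?_
  have : S.E₁₁ - S.E₁₂ * ⅟(-S.A₂₂) * (-S.A₂₁) = S.schur := by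
    change S.E₁₁ - S.E₁₂ * (-S.A₂₂⁻¹) * (-S.A₂₁) = S.schur
    simp [schur]
  rw [this]
  exact h.2

/-- `M₁` and `M₂` form the second block column of the inverse of `infinityMatrix`. -/
theorem infinityMatrix_mul (h : S.IsIndexOne) :
    S.infinityMatrix * fromRows (S.M₁ * S.B₂) (S.M₂ * S.B₂) = fromRows 0 S.B₂ := by
  have hs : S.E₁₁ = S.schur + S.E₁₂ * S.A₂₂⁻¹ * S.A₂₁ := by simp [schur]
  rw [infinityMatrix, fromBlocks_mul_fromRows, ← Matrix.mul_assoc, ← Matrix.mul_assoc,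
    ← Matrix.add_mul, ← Matrix.mul_assoc, ← Matrix.mul_assoc, ← Matrix.add_mul]
  have h1 : S.E₁₁ * S.M₁ + S.E₁₂ * S.M₂ = 0 := by
    rw [hs, Matrix.add_mul]
    have : S.schur * S.M₁ = S.E₁₂ * S.A₂₂⁻¹ := by
      rw [M₁, Matrix.mul_assoc S.schur⁻¹, mul_nonsing_inv_cancel_left _ _ h.2]
    rw [this, M₁, M₂]
    simp only [Matrix.mul_sub, Matrix.mul_neg, Matrix.mul_assoc]
    abel
  have h2 : -S.A₂₁ * S.M₁ + -S.A₂₂ * S.M₂ = 1 := by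
    rw [M₁, M₂]
    simp only [Matrix.mul_sub, Matrix.mul_neg, Matrix.neg_mul, Matrix.mul_assoc,
      mul_nonsing_inv_cancel_left _ _ h.1, mul_nonsing_inv _ h.1]
    abel
  rw [h1, h2, Matrix.zero_mul, Matrix.one_mul]

theorem tendsto_transfer (h : S.IsIndexOne) :
    Tendsto S.toModel.transfer (cocompact ℂ) (𝓝 S.reducedD) := by
  -- The projection onto the algebraic equations; with it `E - K * A` becomes `infinityMatrix`.
  set KR : Matrix (Fin n₁ ⊕ Fin n₂) (Fin n₁ ⊕ Fin n₂) ℝ := fromBlocks 0 0 0 1 with hKR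
  let K := KR.map Complex.ofRealHom
  have hK : K * K = K := by
    simp only [K, ← Matrix.map_mul, hKR, fromBlocks_multiply]; simp
  have hKE : K * S.toModel.E = 0 := by
    change KR.map Complex.ofRealHom * Matrix.map _ Complex.ofRealHom = 0
    rw [← Matrix.map_mul, hKR, fromBlocks_multiply]
    simp
  have hN : S.toModel.E - K * S.toModel.A = S.infinityMatrix.map Complex.ofRealHom := by
    change Matrix.map _ Complex.ofRealHom - KR.map Complex.ofRealHom *
      Matrix.map _ Complex.ofRealHom = _
    rw [← Matrix.map_mul, ← Matrix.map_sub _ (map_sub Complex.ofRealHom), hKR, fromBlocks_multiply,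
      infinityMatrix, sub_eq_add_neg, fromBlocks_neg, fromBlocks_add]
    simp
  have hKB : K * S.toModel.B = (fromRows 0 S.B₂).map Complex.ofRealHom := by
    change KR.map Complex.ofRealHom * Matrix.map _ Complex.ofRealHom = _
    rw [← Matrix.map_mul, hKR, fromBlocks_mul_fromRows]
    simp
  have hdet : IsUnit (S.infinityMatrix.map Complex.ofRealHom).det := by
    have := (isUnit_det_infinityMatrix h).map Complex.ofRealHom
    rwa [RingHom.map_det] at this
  have hsol : (S.infinityMatrix.map Complex.ofRealHom)⁻¹ * (K * S.toModel.B) =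
      (fromRows (S.M₁ * S.B₂) (S.M₂ * S.B₂)).map Complex.ofRealHom := by
    rw [hKB, ← infinityMatrix_mul h, Matrix.map_mul, nonsing_inv_mul_cancel_left _ _ hdet]
  have := Model.tendsto_transfer_cocompact S.toModel K hK hKE (hN ▸ hdet)
  rw [hN, Matrix.mul_assoc, hsol] at this
  convert this
  change _ = Matrix.map _ Complex.ofRealHom * _ + Matrix.map _ Complex.ofRealHom
  rw [← Matrix.map_mul, ← Matrix.map_add _ (map_add Complex.ofRealHom), fromCols_mul_fromRows,
    ← Matrix.mul_assoc, ← Matrix.mul_assoc]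
  rfl

/-! ### Bi-tangential Hermite interpolation by the reduced model. -/

section Interpolation

variable {d : IRKAData r m p}

theorem pencil_mulVec_V_col {i : Fin r} (h : S.toModel.RegularAt (d.σ i)) :
    S.toModel.pencil (d.σ i) *ᵥ (S.V d).col i = S.toModel.B *ᵥ d.b i := by
  change S.toModel.pencil (d.σ i) *ᵥ ((S.toModel.pencil (d.σ i))⁻¹ *ᵥ (S.toModel.B *ᵥ d.b i)) = _
  rw [mulVec_mulVec, mul_nonsing_inv _ h, one_mulVec]

theorem W_col_vecMul_pencil {i : Fin r} (h : S.toModel.RegularAt (d.σ i)) :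
    (S.W d).col i ᵥ* S.toModel.pencil (d.σ i) = d.c i ᵥ* S.toModel.C := by
  change ((S.toModel.pencil (d.σ i))⁻¹ᵀ *ᵥ (S.toModel.Cᵀ *ᵥ d.c i)) ᵥ* _ = _
  rw [mulVec_transpose, mulVec_transpose, vecMul_vecMul, nonsing_inv_mul _ h, vecMul_one]

theorem reducedModel_pencil (s : ℂ) : (S.reducedModel d).pencil s =
    (S.W d)ᵀ * S.toModel.pencil s * S.V d - d.cMatrixᵀ * S.shiftD * d.bMatrix := by
  simp only [Model.pencil, reducedModel, Matrix.mul_sub, Matrix.sub_mul, Matrix.mul_smul,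
    Matrix.smul_mul]
  abel

theorem bMatrix_mulVec_single (i : Fin r) : d.bMatrix *ᵥ Pi.single i 1 = d.b i := by
  rw [mulVec_single_one]; rfl

theorem single_vecMul_cMatrix_transpose (i : Fin r) :
    Pi.single i 1 ᵥ* d.cMatrixᵀ = d.c i := by
  rw [single_one_vecMul]; rfl

/-- The unit vector `e_i` solves the reduced linear system whose full counterpart is solved by `V
e_i`: the shift terms in the reduced `A` and `B` match because `d.bMatrix` sends `e_i` to `b_i`. -/
theorem reducedModel_pencil_mulVec {i : Fin r} (h : S.toModel.RegularAt (d.σ i)) :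
    (S.reducedModel d).pencil (d.σ i) *ᵥ Pi.single i 1 = (S.reducedModel d).B *ᵥ d.b i := by
  rw [reducedModel_pencil, sub_mulVec, ← mulVec_mulVec, ← mulVec_mulVec, ← mulVec_mulVec,
    bMatrix_mulVec_single, mulVec_single_one, pencil_mulVec_V_col h, reducedModel, sub_mulVec,
    mulVec_mulVec]

theorem vecMul_reducedModel_pencil {i : Fin r} (h : S.toModel.RegularAt (d.σ i)) :
    Pi.single i 1 ᵥ* (S.reducedModel d).pencil (d.σ i) = d.c i ᵥ* (S.reducedModel d).C := by
  rw [reducedModel_pencil, vecMul_sub, ← vecMul_vecMul, ← vecMul_vecMul, ← vecMul_vecMul,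
    ← vecMul_vecMul, single_vecMul_cMatrix_transpose, single_one_vecMul,
    show (S.W d)ᵀ.row i = (S.W d).col i from rfl, W_col_vecMul_pencil h, reducedModel, vecMul_sub,
    vecMul_vecMul, vecMul_vecMul]

/-- The correction `-shiftD * b_i` in the reduced output cancels the change of feedthrough. -/
theorem transfer_mulVec_eq {i : Fin r} (h : S.toModel.RegularAt (d.σ i))
    (h' : (S.reducedModel d).RegularAt (d.σ i)) :
    S.toModel.transfer (d.σ i) *ᵥ d.b i = (S.reducedModel d).transfer (d.σ i) *ᵥ d.b i := by
  rw [Model.transfer_mulVec h (pencil_mulVec_V_col h),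
    Model.transfer_mulVec h' (reducedModel_pencil_mulVec h)]
  simp only [reducedModel, sub_mulVec]
  rw [← mulVec_mulVec, ← mulVec_mulVec, bMatrix_mulVec_single, mulVec_single_one, shiftD,
    sub_mulVec]
  abel

theorem vecMul_transfer_eq {i : Fin r} (h : S.toModel.RegularAt (d.σ i))
    (h' : (S.reducedModel d).RegularAt (d.σ i)) :
    d.c i ᵥ* S.toModel.transfer (d.σ i) = d.c i ᵥ* (S.reducedModel d).transfer (d.σ i) := by
  rw [Model.vecMul_transfer h (W_col_vecMul_pencil h),
    Model.vecMul_transfer h' (vecMul_reducedModel_pencil h)]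
  simp only [reducedModel, vecMul_sub]
  rw [← vecMul_vecMul, ← vecMul_vecMul, single_vecMul_cMatrix_transpose, single_one_vecMul, shiftD,
    vecMul_sub, show (S.W d)ᵀ.row i = (S.W d).col i from rfl]
  abel

/-- Both sides are `-(W e_i)ᵀ E (V e_i)`; the reduced `E` carries no shift term. -/
theorem transferDeriv_bilinear_eq {i : Fin r} (h : S.toModel.RegularAt (d.σ i))
    (h' : (S.reducedModel d).RegularAt (d.σ i)) :
    d.c i ⬝ᵥ (S.toModel.transferDeriv (d.σ i) *ᵥ d.b i) =
      d.c i ⬝ᵥ ((S.reducedModel d).transferDeriv (d.σ i) *ᵥ d.b i) := by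
  rw [Model.dotProduct_transferDeriv_mulVec h (pencil_mulVec_V_col h) (W_col_vecMul_pencil h),
    Model.dotProduct_transferDeriv_mulVec h' (reducedModel_pencil_mulVec h)
      (vecMul_reducedModel_pencil h)]
  simp only [reducedModel]
  rw [← mulVec_mulVec, ← mulVec_mulVec, dotProduct_mulVec (Pi.single i 1), mulVec_single_one,
    single_one_vecMul]
  rfl

/-- If `b_i = 0`, column `i` of `V` vanishes, and `e_i` lies in the kernel of the reduced `E`. -/
theorem b_ne_zero (hE : IsUnit (S.reducedModel d).E.det) (i : Fin r) : d.b i ≠ 0 := by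
  intro h
  refine hE.ne_zero ?_
  refine exists_mulVec_eq_zero_iff.1 ⟨Pi.single i 1, by simp, ?_⟩
  have hV : (S.V d).col i = 0 := by
    ext k
    simp [V, h]
  simp only [reducedModel]
  rw [← mulVec_mulVec, mulVec_single_one, hV, mulVec_zero]

theorem c_ne_zero (hE : IsUnit (S.reducedModel d).E.det) (i : Fin r) : d.c i ≠ 0 := by
  intro h
  refine hE.ne_zero ?_
  refine exists_vecMul_eq_zero_iff.1 ⟨Pi.single i 1, by simp, ?_⟩
  have hW : (S.W d)ᵀ.row i = 0 := by
    ext k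
    simp [W, h]
  simp only [reducedModel]
  rw [← vecMul_vecMul, ← vecMul_vecMul, single_one_vecMul, hW, zero_vecMul, zero_vecMul]

end Interpolation

/-! ### Passage to the limit along the iteration. -/

section Limit

variable {d : ℕ → IRKAData r m p} {dlim : IRKAData r m p}

theorem tendsto_inv_pencil (hconv : IRKAData.ConvergesTo d dlim) {i : Fin r}
    (hfull : S.toModel.RegularAt (dlim.σ i)) :
    Tendsto (fun k => (S.toModel.pencil ((d k).σ i))⁻¹) atTop
      (𝓝 (S.toModel.pencil (dlim.σ i))⁻¹) :=
  tendsto_matrix_inv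
    ((S.toModel.continuous_pencil.tendsto _).comp (tendsto_pi_nhds.1 hconv.1 i)) hfull

theorem tendsto_V (hconv : IRKAData.ConvergesTo d dlim)
    (hfull : ∀ i, S.toModel.RegularAt (dlim.σ i)) :
    Tendsto (fun k => S.V (d k)) atTop (𝓝 (S.V dlim)) := by
  refine tendsto_pi_nhds.2 fun a => tendsto_pi_nhds.2 fun i => ?_
  have hc : Continuous fun q : Matrix (Fin n₁ ⊕ Fin n₂) (Fin n₁ ⊕ Fin n₂) ℂ × (Fin m → ℂ) =>
      (q.1 *ᵥ (S.toModel.B *ᵥ q.2)) a :=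
    (continuous_apply a).comp
      (continuous_fst.matrix_mulVec (continuous_const.matrix_mulVec continuous_snd))
  have hp := (tendsto_inv_pencil hconv (hfull i)).prodMk_nhds (tendsto_pi_nhds.1 hconv.2.1 i)
  have := (hc.tendsto ((S.toModel.pencil (dlim.σ i))⁻¹, dlim.b i)).comp hp
  simpa only [V, of_apply, Function.comp_def] using this

theorem tendsto_W_transpose (hconv : IRKAData.ConvergesTo d dlim)
    (hfull : ∀ i, S.toModel.RegularAt (dlim.σ i)) :
    Tendsto (fun k => (S.W (d k))ᵀ) atTop (𝓝 (S.W dlim)ᵀ) := by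
  refine tendsto_pi_nhds.2 fun i => tendsto_pi_nhds.2 fun a => ?_
  have hc : Continuous fun q : Matrix (Fin n₁ ⊕ Fin n₂) (Fin n₁ ⊕ Fin n₂) ℂ × (Fin p → ℂ) =>
      (q.1ᵀ *ᵥ (S.toModel.Cᵀ *ᵥ q.2)) a :=
    (continuous_apply a).comp
      (continuous_fst.matrix_transpose.matrix_mulVec (continuous_const.matrix_mulVec continuous_snd))
  have hp := (tendsto_inv_pencil hconv (hfull i)).prodMk_nhds (tendsto_pi_nhds.1 hconv.2.2 i)
  have := (hc.tendsto ((S.toModel.pencil (dlim.σ i))⁻¹, dlim.c i)).comp hp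
  simpa only [W, transpose_apply, of_apply, Function.comp_def] using this

theorem tendsto_bMatrix (hconv : IRKAData.ConvergesTo d dlim) :
    Tendsto (fun k => (d k).bMatrix) atTop (𝓝 dlim.bMatrix) :=
  (continuous_id.matrix_transpose.tendsto (Matrix.of dlim.b)).comp hconv.2.1

theorem tendsto_cMatrix_transpose (hconv : IRKAData.ConvergesTo d dlim) :
    Tendsto (fun k => (d k).cMatrixᵀ) atTop (𝓝 dlim.cMatrixᵀ) :=
  hconv.2.2

theorem tendsto_reducedModel (hconv : IRKAData.ConvergesTo d dlim)
    (hfull : ∀ i, S.toModel.RegularAt (dlim.σ i)) :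
    Tendsto (fun k => (S.reducedModel (d k)).E) atTop (𝓝 (S.reducedModel dlim).E) ∧
    Tendsto (fun k => (S.reducedModel (d k)).A) atTop (𝓝 (S.reducedModel dlim).A) ∧
    Tendsto (fun k => (S.reducedModel (d k)).B) atTop (𝓝 (S.reducedModel dlim).B) ∧
    Tendsto (fun k => (S.reducedModel (d k)).C) atTop (𝓝 (S.reducedModel dlim).C) := by
  have hV := tendsto_V hconv hfull
  have hW := tendsto_W_transpose hconv hfull
  have hcD := tendsto_matrix_mul (tendsto_cMatrix_transpose hconv)
    (tendsto_const_nhds (x := S.shiftD))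
  have hb := tendsto_bMatrix hconv
  exact ⟨tendsto_matrix_mul (tendsto_matrix_mul hW tendsto_const_nhds) hV,
    (tendsto_matrix_mul (tendsto_matrix_mul hW tendsto_const_nhds) hV).add
      (tendsto_matrix_mul hcD hb),
    (tendsto_matrix_mul hW tendsto_const_nhds).sub hcD,
    (tendsto_matrix_mul tendsto_const_nhds hV).sub (tendsto_matrix_mul tendsto_const_nhds hb)⟩

theorem tendsto_neg_shift (hconv : IRKAData.ConvergesTo d dlim) (i : Fin r) :
    Tendsto (fun k => -(d (k + 1)).σ i) atTop (𝓝 (-dlim.σ i)) :=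
  ((tendsto_add_atTop_iff_nat 1).2 (tendsto_pi_nhds.1 hconv.1 i)).neg

/-- The eigenvalues of the limiting pencil are the negatives of the limiting shifts. -/
theorem det_limit_pencil (hrun : ∀ k, S.IRKAStep (d k) (d (k + 1)))
    (hconv : IRKAData.ConvergesTo d dlim)
    (hfull : ∀ i, S.toModel.RegularAt (dlim.σ i)) (s : ℂ) :
    ((S.reducedModel dlim).pencil s).det =
      (S.reducedModel dlim).E.det * ∏ j, (s - -dlim.σ j) := by
  obtain ⟨hE, hA, -, -⟩ := tendsto_reducedModel (S := S) hconv hfull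
  -- The matrices of step `k` are paired with the shifts of step `k + 1`; both sequences have the
  -- limits belonging to `dlim`.
  have hstep : ∀ k, (s • (S.reducedModel (d k)).E - (S.reducedModel (d k)).A).det =
      (S.reducedModel (d k)).E.det * ∏ j, (s - -(d (k + 1)).σ j) := fun k => by
    obtain ⟨-, lam, Y, Z, hYA, hYE, hd⟩ := hrun k
    rw [det_pencil_of_diagonalized hYA hYE]
    simp only [fun i => (hd i).1, neg_neg]
  have h1 := (continuous_id.matrix_det.tendsto _).comp ((hE.const_smul s).sub hA)
  have h2 := ((continuous_id.matrix_det.tendsto _).comp hE).mul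
    (tendsto_finsetProd Finset.univ fun j _ =>
      (tendsto_const_nhds (x := s)).sub (tendsto_neg_shift hconv j))
  exact tendsto_nhds_unique (h1.congr hstep) h2

/-- The residue of the limiting reduced model at `-σ i` is a multiple of `c i (b i)ᵀ`. -/
theorem adjugate_limit_pencil (hrun : ∀ k, S.IRKAStep (d k) (d (k + 1)))
    (hconv : IRKAData.ConvergesTo d dlim)
    (hfull : ∀ i, S.toModel.RegularAt (dlim.σ i)) (i : Fin r) :
    (S.reducedModel dlim).C * ((S.reducedModel dlim).pencil (-dlim.σ i)).adjugate *
        (S.reducedModel dlim).B =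
      ((S.reducedModel dlim).E.det * ∏ j ∈ Finset.univ.erase i, (-dlim.σ i - -dlim.σ j)) •
        vecMulVec (dlim.c i) (dlim.b i) := by
  obtain ⟨hE, hA, hB, hC⟩ := tendsto_reducedModel (S := S) hconv hfull
  -- Eigenvectors enter only through `C z_i` and `y_i^* B`, which are the new directions. The
  -- adjugate, unlike the inverse, exists and is continuous at the poles.
  have hstep : ∀ k, (S.reducedModel (d k)).C *
      (-(d (k + 1)).σ i • (S.reducedModel (d k)).E - (S.reducedModel (d k)).A).adjugate *
        (S.reducedModel (d k)).B =
      ((S.reducedModel (d k)).E.det *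
        ∏ j ∈ Finset.univ.erase i, (-(d (k + 1)).σ i - -(d (k + 1)).σ j)) •
        vecMulVec ((d (k + 1)).c i) ((d (k + 1)).b i) := fun k => by
    obtain ⟨-, lam, Y, Z, hYA, hYE, hd⟩ := hrun k
    simp only [fun i => (hd i).1, neg_neg]
    rw [adjugate_pencil_of_diagonalized hYA hYE, Matrix.mul_smul, Matrix.smul_mul,
      mul_vecMulVec_mul, (hd i).2.1, (hd i).2.2]
    rfl
  have hσ := tendsto_neg_shift hconv
  have h1 := tendsto_matrix_mul (tendsto_matrix_mul hC
    ((continuous_id.matrix_adjugate.tendsto _).comp (((hσ i).smul hE).sub hA))) hB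
  have hc : Tendsto (fun k => (d (k + 1)).c i) atTop (𝓝 (dlim.c i)) :=
    (tendsto_add_atTop_iff_nat 1).2 (tendsto_pi_nhds.1 hconv.2.2 i)
  have hb : Tendsto (fun k => (d (k + 1)).b i) atTop (𝓝 (dlim.b i)) :=
    (tendsto_add_atTop_iff_nat 1).2 (tendsto_pi_nhds.1 hconv.2.1 i)
  have hcb : Tendsto (fun k => vecMulVec ((d (k + 1)).c i) ((d (k + 1)).b i)) atTop
      (𝓝 (vecMulVec (dlim.c i) (dlim.b i))) :=
    (((continuous_fst (X := Fin p → ℂ) (Y := Fin m → ℂ)).matrix_vecMulVec continuous_snd).tendsto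
      (_, _)).comp (hc.prodMk_nhds hb)
  have h2 := (((continuous_id.matrix_det.tendsto _).comp hE).mul
    (tendsto_finsetProd (Finset.univ.erase i) fun j _ => (hσ i).sub (hσ j))).smul hcb
  exact tendsto_nhds_unique (h1.congr hstep) h2

end Limit

end SemiExplicitSystem

end

end DescriptorH2


/-! ### The necessary conditions for the limit. -/

open DescriptorH2 SemiExplicitSystem in
theorem corollary5p3 {n₁ n₂ m p r : ℕ}
    (S : DescriptorH2.SemiExplicitSystem n₁ n₂ m p) (hindex : S.IsIndexOne)
    -- a run of the iteration, from arbitrary initial data, that converges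
    (d : ℕ → DescriptorH2.IRKAData r m p) (hrun : ∀ k, S.IRKAStep (d k) (d (k + 1)))
    (dlim : DescriptorH2.IRKAData r m p) (hconv : DescriptorH2.IRKAData.ConvergesTo d dlim)
    -- the limiting shifts are distinct, and the limiting data define a reduced model that
    -- can be evaluated at them
    (hdistinct : Function.Injective dlim.σ)
    (hfull : ∀ i, S.toModel.RegularAt (dlim.σ i))
    (hE : IsUnit (S.reducedModel dlim).E.det)
    (hred : ∀ i, (S.reducedModel dlim).RegularAt (dlim.σ i)) :
    DescriptorH2.SatisfiesH2NecessaryConditions S.toModel (S.reducedModel dlim) := by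
  have hdet := det_limit_pencil hrun hconv hfull
  have hpole : ∀ i, ((S.reducedModel dlim).pencil (-dlim.σ i)).det = 0 := fun i => by
    rw [hdet, Finset.prod_eq_zero (Finset.mem_univ i) (sub_self _), mul_zero]
  refine ⟨hE, ⟨S.reducedD.map Polynomial.C,
    Model.isPolynomialPart_of_tendsto (tendsto_transfer hindex),
    Model.isPolynomialPart_of_tendsto ?_⟩, ⟨fun i => -dlim.σ i,
    exists_isSpectralData _ hE _ (neg_injective.comp hdistinct) hpole⟩, ?_⟩
  -- The reduced `E` is nonsingular, so there is no algebraic part and `K = 0` serves.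
  · simpa [reducedModel] using Model.tendsto_transfer_cocompact (S.reducedModel dlim) 0
      (by simp) (by simp) (by simpa using hE)
  · intro lam y z hspec i
    obtain ⟨hA, hE'⟩ := hspec.diagonalize
    -- The given spectral data may be numbered differently from the shifts; the two factorizations
    -- of the determinant match them.
    obtain ⟨j, hj⟩ : ∃ j, lam i = -dlim.σ j := by
      have h0 := det_pencil_of_diagonalized hA hE' (lam i)
      rw [Finset.prod_eq_zero (Finset.mem_univ i) (sub_self _), mul_zero] at h0
      have h1 := (hdet (lam i)).symm.trans h0
      obtain ⟨j, -, hj⟩ := Finset.prod_eq_zero_iff.1 ((mul_eq_zero.1 h1).resolve_left hE.ne_zero)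
      exact ⟨j, sub_eq_zero.1 hj⟩
    -- The same adjugate is computed from the limit and from the given eigenvectors, so the two
    -- rank-one residues are proportional.
    have hres := adjugate_limit_pencil hrun hconv hfull j
    rw [← hj, Model.pencil, adjugate_pencil_of_diagonalized hA hE', Matrix.mul_smul,
      Matrix.smul_mul, mul_vecMulVec_mul] at hres
    have hne : (S.reducedModel dlim).E.det *
        ∏ k ∈ Finset.univ.erase j, (lam i - -dlim.σ k) ≠ 0 := by
      refine mul_ne_zero hE.ne_zero (Finset.prod_ne_zero_iff.2 fun k hk => ?_)
      rw [hj, sub_ne_zero]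
      exact fun h => (Finset.ne_of_mem_erase hk) (hdistinct (neg_injective h)).symm
    obtain ⟨hb, hc, ⟨u, hu⟩, ⟨v, hv⟩⟩ :=
      exists_smul_of_vecMulVec_eq hne (c_ne_zero hE j) (b_ne_zero hE j) hres.symm
    change star (y i) ᵥ* (S.reducedModel dlim).B = _ at hu
    change (S.reducedModel dlim).C *ᵥ z i = _ at hv
    have hσ : -lam i = dlim.σ j := by rw [hj, neg_neg]
    refine ⟨hb, hc, hσ ▸ hfull j, hσ ▸ hred j, ?_, ?_, ?_⟩
    · rw [hu, hσ, mulVec_smul, mulVec_smul, transfer_mulVec_eq (hfull j) (hred j)]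
    · rw [hv, hσ, smul_vecMul, smul_vecMul, vecMul_transfer_eq (hfull j) (hred j)]
    · rw [hu, hv, hσ, mulVec_smul, mulVec_smul, smul_dotProduct, smul_dotProduct, dotProduct_smul,
        dotProduct_smul, transferDeriv_bilinear_eq (hfull j) (hred j)]
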